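/- Angles are in radians. Let $0<\alpha<\pi/4$ (that is, $0^\circ<\alpha<45^\circ$) be such that $k=\pi/\alpha$ is an integer, and let $S$ be a finite set of $n$ points in the plane. **Definitions.** For a non-degenerate triangle $ABC$ and a point $q$, let $W_{q,a}=\{q+s(B-A)+t(C-A): s,t\ge 0\}$. The $a$-nearest neighbour of $q\in S$ is the first point of $(S\setminus\{q\})\cap W_{q,a}$ (if there is one) that is hit when a line parallel to $BC$, starting at $q$, sweeps over $W_{q,a}$; among several points hit first, the most clockwise one as seen from $q$ is taken. The $b$- and $c$-nearest neighbours are defined in the same way at the corners $B$ and $C$. The *3-sweep graph* of $S$ for $ABC$ joins every $q\in S$ to its $a$-, $b$- and $c$-nearest neighbours. Let $\Delta_1$ be a triangle $ABC$ with $A,B,C$ in clockwise order, with angles $2\alpha,\ \pi/2-\alpha,\ \pi/2-\alpha$ at $A,B,C$, and such that the vertically upward ray from $A$ bisects the angle at $A$. For $1\le i\le k$ let $\Delta_i$ be $\Delta_1$ rotated clockwise about $A$ by $\frac{i-1}{k}2\pi$, and let $G_i$ be the 3-sweep graph of $S$ for $\Delta_i$. The *$k$-layer 3-sweep graph* is $H_k=G_1\cup\dots\cup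 G_k$. A graph on $S$ is *angle-monotone of width $\gamma$* if every two vertices $s,t$ are joined by a path from $s$ to $t$ such that the vectors of all its edges, directed from $s$ to $t$ along the path, lie in a common wedge of angle $\gamma$. The *(full) $\Theta_6$-graph* of $S$ joins every $q\in S$, for each of the six closed cones with apex $q$ and direction angles in $[j\pi/3,(j+1)\pi/3]$, $0\le j\le 5$, to the point of $S\setminus\{q\}$ in the cone whose orthogonal projection to the bisector of the cone is closest to $q$ (if the cone contains such points), ties being broken by taking the most clockwise point. **Theorem.** There is an absolute constant $c>0$ such that for all $\alpha$, $k$, $S$ as above: 1. $H_k$ is angle-monotone of width $\pi/2+\alpha$ and has at most $c\,n/\alpha$ edges; 2. the same holds, with the same $c$, for every graph obtained by the construction of $H_k$ when ties among the points hit first are broken arbitrarily; 3. if $\alpha=\pi/6$ (so $k=6$), then $H_k$ is the full $\Theta_6$-graph of $S$. -/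

import Mathlib

noncomputable section

/-- The Euclidean plane. -/
abbrev Plane : Type := EuclideanSpace ℝ (Fin 2)

/-- The unit vector that makes the counterclockwise angle `θ` (radians) with the positive x-axis. -/
def dir (θ : ℝ) : Plane := !₂[Real.cos θ, Real.sin θ]

/-- The planar cross product; for vectors spanning less than a half-turn it is positive exactly
when `v` is counterclockwise of `u`. -/
def cross (u v : Plane) : ℝ := u 0 * v 1 - u 1 * v 0

/-- `v` lies in the (closed) wedge of angle `γ` at the origin, whose directions are the angles
in `[φ, φ + γ]`. -/
def InWedge (φ γ : ℝ) (v : Plane) : Prop :=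
  ∃ r ψ : ℝ, 0 ≤ r ∧ φ ≤ ψ ∧ ψ ≤ φ + γ ∧ v = r • dir ψ

/-- A walk (read from `s` to `t`) is angle-monotone of width `γ` if some wedge of angle `γ`
contains the vectors of all its edges. -/
def IsAngleMonotoneWalk {S : Finset Plane} {G : SimpleGraph S} (γ : ℝ) {s t : S}
    (w : G.Walk s t) : Prop :=
  ∃ φ : ℝ, ∀ d ∈ w.darts, InWedge φ γ ((d.snd : Plane) - (d.fst : Plane))

/-- A geometric graph on `S` is angle-monotone of width `γ` if every two vertices are joined by
an angle-monotone path of width `γ`. -/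
def IsAngleMonotone {S : Finset Plane} (γ : ℝ) (G : SimpleGraph S) : Prop :=
  ∀ s t : S, ∃ w : G.Walk s t, w.IsPath ∧ IsAngleMonotoneWalk γ w

/-- The wedge of `q` at the corner `A` of the triangle `A B C`: apex `q`, sides parallel to
`AB` and `AC`. -/
def wedge (A B C q : Plane) : Set Plane :=
  {p | ∃ s t : ℝ, 0 ≤ s ∧ 0 ≤ t ∧ p = q + s • (B - A) + t • (C - A)}

/-- The sweep line of the wedge of `q` at the corner `A`: parallel to `BC`, at time `l`.
At time `0` it passes through `q`, and it moves across the wedge as `l` grows. -/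
def sweepLine (A B C q : Plane) (l : ℝ) : Set Plane :=
  {p | ∃ t : ℝ, p = q + l • (B - A) + t • (C - B)}

/-- For the corner `T j` of the triangle `T 0, T 1, T 2`: among the points of `S` other than `q`
in the wedge of `q` at that corner, `p` is one of those that the sweep line hits first. -/
def IsNearest (S : Finset Plane) (T : Fin 3 → Plane) (j : Fin 3) (q p : S) : Prop :=
  p ≠ q ∧ (p : Plane) ∈ wedge (T j) (T (j + 1)) (T (j + 2)) q ∧
    ∃ l : ℝ, (p : Plane) ∈ sweepLine (T j) (T (j + 1)) (T (j + 2)) q l ∧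
      ∀ r : S, r ≠ q → (r : Plane) ∈ wedge (T j) (T (j + 1)) (T (j + 2)) q →
        ∀ m : ℝ, (r : Plane) ∈ sweepLine (T j) (T (j + 1)) (T (j + 2)) q m → l ≤ m

/-- Ties broken clockwise: `p` is the most clockwise point, as seen from `q`, among the points
related to `q` by `N`. -/
def MostClockwise {S : Finset Plane} (N : S → S → Prop) (q p : S) : Prop :=
  N q p ∧ ∀ r : S, N q r → r ≠ p →
    0 < cross ((p : Plane) - (q : Plane)) ((r : Plane) - (q : Plane))

/-- Ties broken arbitrarily: `R` keeps exactly one of the points related to `q` by `N`, for each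
`q` that has any. -/
def IsTieBreak {S : Finset Plane} (N R : S → S → Prop) : Prop :=
  (∀ q p, R q p → N q p) ∧ ∀ q, (∃ p, N q p) → ∃! p, R q p

/-- The 3-sweep graph of `S` for the triangle `T`, ties broken clockwise: every point is joined
to its nearest neighbours for the three corners. -/
def threeSweepGraph (S : Finset Plane) (T : Fin 3 → Plane) : SimpleGraph S :=
  SimpleGraph.fromRel fun q p => ∃ j : Fin 3, MostClockwise (IsNearest S T j) q p

/-- `G` is a 3-sweep graph of `S` for the triangle `T`, with some way of breaking ties. -/
def IsThreeSweepGraph (S : Finset Plane) (T : Fin 3 → Plane) (G : SimpleGraph S) : Prop :=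
  ∃ R : Fin 3 → S → S → Prop, (∀ j, IsTieBreak (IsNearest S T j) (R j)) ∧
    G = SimpleGraph.fromRel fun q p => ∃ j : Fin 3, R j q p

/-- The triangle `A B C` (in clockwise order) with `A` at the origin, angle `2 * α` at `A`, equal
sides `AB` and `AC`, and upward bisector at `A`, rotated clockwise about `A` by `θ`. -/
def rotatedTriangle (α θ : ℝ) : Fin 3 → Plane :=
  ![0, dir (Real.pi / 2 + α - θ), dir (Real.pi / 2 - α - θ)]

/-- The triangle of the `i`-th layer, `i = 0, …, k - 1`: rotated clockwise by `i / k` of a full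
turn. -/
def layerTriangle (α : ℝ) (k : ℕ) (i : Fin k) : Fin 3 → Plane :=
  rotatedTriangle α ((i : ℕ) / (k : ℝ) * (2 * Real.pi))

/-- The `k`-layer 3-sweep graph of `S` with respect to `α`, ties broken clockwise. -/
def layeredSweepGraph (S : Finset Plane) (α : ℝ) (k : ℕ) : SimpleGraph S :=
  ⨆ i : Fin k, threeSweepGraph S (layerTriangle α k i)

/-- `H` is a `k`-layer 3-sweep graph of `S` with respect to `α`, with some way of breaking the
ties in each layer. -/
def IsLayeredSweepGraph (S : Finset Plane) (α : ℝ) (k : ℕ) (H : SimpleGraph S) : Prop :=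
  ∃ G : Fin k → SimpleGraph S, (∀ i, IsThreeSweepGraph S (layerTriangle α k i) (G i)) ∧
    H = ⨆ i, G i

/-- Among the points of `S` other than `q` in the `j`-th of the six cones of angle `π / 3` with
apex `q`, `p` is one of those whose projection to the bisector of the cone is closest to `q`. -/
def IsThetaNearest (S : Finset Plane) (j : Fin 6) (q p : S) : Prop :=
  p ≠ q ∧ InWedge ((j : ℕ) * (Real.pi / 3)) (Real.pi / 3) ((p : Plane) - (q : Plane)) ∧
    ∀ r : S, r ≠ q →
      InWedge ((j : ℕ) * (Real.pi / 3)) (Real.pi / 3) ((r : Plane) - (q : Plane)) →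
        inner ℝ ((p : Plane) - (q : Plane)) (dir ((j : ℕ) * (Real.pi / 3) + Real.pi / 6)) ≤
          inner ℝ ((r : Plane) - (q : Plane)) (dir ((j : ℕ) * (Real.pi / 3) + Real.pi / 6))

/-- The (full) Θ₆-graph of `S`, ties broken clockwise. -/
def thetaSixGraph (S : Finset Plane) : SimpleGraph S :=
  SimpleGraph.fromRel fun q p => ∃ j : Fin 6, MostClockwise (IsThetaNearest S j) q p

end

/-! For one triangle, let X, Y, Z be the negated side heights of A, B, C, shifted cyclically so that
X belongs to B, Y to C and Z to A. They sum to zero, and the wedge at A is the quadrant where X and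
Y grow, swept in the order of X + Y. The wedges at B and C are the quadrants of Y, Z and of Z, X.

Let t lie in the A-wedge of s. Follow A-neighbours from s while t stays in the wedge. When it leaves
through one side, the current point lies in the C-wedge (or B-wedge) of t. From then on, advance
from whichever end sees the other: by A-neighbours at the front, by C-neighbours (or B-neighbours)
at the back. Minimality of the chosen neighbours shows that the ends keep seeing each other or meet
(`reflTransGen_zigzag`, `reflTransGen_of_mem_quadrant`).

Only A-edges and reversed C-edges (or reversed B-edges) occur. The A-wedge and the reflected C- or
B-wedge share a ray, so the directions fill a wedge of angle 2α + (π/2 - α) = π/2 + α. The k rotated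
A-wedges have angle 2α = 2π/k and cover the plane, so every pair is served by some layer. No tie
rule enters, and the clockwise rule is one instance (`isTieBreak_mostClockwise`). Each point selects
at most 3k neighbours, whence c = 3π. For α = π/6 the triangles are equilateral and the wedges are
the Θ₆ cones. -/

/-! ### Chains of nearest neighbours in abstract coordinates -/

/-- `R` relates each `q` to points of the quadrant of `q` (with respect to `f` and `g`) at which
`f + g` is least, and to at least one such point if the quadrant contains a point besides `q`. -/
def IsQuadrantSelector {V : Type*} (f g : V → ℝ) (R : V → V → Prop) : Prop :=
  (∀ q p, R q p → p ≠ q ∧ f q ≤ f p ∧ g q ≤ g p ∧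
    ∀ r, r ≠ q → f q ≤ f r → g q ≤ g r → f p + g p ≤ f r + g r) ∧
  ∀ q r, r ≠ q → f q ≤ f r → g q ≤ g r → ∃ p, R q p

lemma IsQuadrantSelector.symm {V : Type*} {f g : V → ℝ} {R : V → V → Prop}
    (h : IsQuadrantSelector f g R) : IsQuadrantSelector g f R :=
  ⟨fun q p hqp => by
    obtain ⟨h1, h2, h3, h4⟩ := h.1 q p hqp
    exact ⟨h1, h3, h2, fun r hr hg hf => by linarith [h4 r hr hf hg]⟩,
    fun q r hr hg hf => h.2 q r hr hf hg⟩

/-- Shrinking an interval of values of `L` at its upper end decreases the number of points. -/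
lemma ncard_between_lt_of_right {V : Type*} [Finite V] (L : V → ℝ) {s t t' : V}
    (hst : L s ≤ L t) (h : L t' < L t) :
    {r | L s ≤ L r ∧ L r ≤ L t'}.ncard < {r | L s ≤ L r ∧ L r ≤ L t}.ncard := by
  apply Set.ncard_lt_ncard _ (Set.toFinite _)
  refine ⟨fun r hr => ⟨hr.1, hr.2.trans h.le⟩, fun hsub => ?_⟩
  exact absurd (hsub (show t ∈ _ from ⟨hst, le_rfl⟩)).2 (not_le.2 h)

/-- Shrinking an interval of values of `L` at its lower end decreases the number of points. -/
lemma ncard_between_lt_of_left {V : Type*} [Finite V] (L : V → ℝ) {s s' t : V}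
    (hst : L s ≤ L t) (h : L s < L s') :
    {r | L s' ≤ L r ∧ L r ≤ L t}.ncard < {r | L s ≤ L r ∧ L r ≤ L t}.ncard := by
  apply Set.ncard_lt_ncard _ (Set.toFinite _)
  refine ⟨fun r hr => ⟨h.le.trans hr.1, hr.2⟩, fun hsub => ?_⟩
  exact absurd (hsub (show s ∈ _ from ⟨le_rfl, hst⟩)).1 (not_le.2 h)

/-- Two points that see each other through the wedges of two corners are joined by a chain that
advances from both ends, using the selected neighbours of one corner at the front and those of
the other corner, reversed, at the back. -/
theorem reflTransGen_zigzag {V : Type*} [Finite V] {X Y : V → ℝ}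
    (inj : ∀ p q, X p = X q → Y p = Y q → p = q) {Ra Rc : V → V → Prop}
    (ha : IsQuadrantSelector X Y Ra)
    (hc : IsQuadrantSelector X (fun p => -(X p + Y p)) Rc) (s t : V) :
    (∀ s₀, Ra s₀ s → X s₀ ≤ X t → Y s₀ ≤ Y t → X t ≤ X s → X s + Y s ≤ X t + Y t →
      Relation.ReflTransGen (fun p q => Ra p q ∨ Rc q p) s₀ t) ∧
    (∀ t₀, Rc t₀ t → X t₀ ≤ X s → X s + Y s ≤ X t₀ + Y t₀ → X s ≤ X t → Y s ≤ Y t →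
      Relation.ReflTransGen (fun p q => Ra p q ∨ Rc q p) s t₀) := by
  -- X + 2Y is the sum of Y and X + Y, the two forms that never decrease along the chain, so it
  -- strictly increases at every step.
  induction hn : {r | X s + 2 * Y s ≤ X r + 2 * Y r ∧ X r + 2 * Y r ≤ X t + 2 * Y t}.ncard
    using Nat.strong_induction_on generalizing s t with
  | _ n ih =>
  subst hn
  constructor
  · intro s₀ hs₀ hX₀ hY₀ hX hZ
    by_cases hst : s = t
    · subst hst
      exact .single (.inl hs₀)
    obtain ⟨t₁, ht₁⟩ := hc.2 t s hst hX (neg_le_neg hZ)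
    obtain ⟨hne, hX₁, hZ₁, hmin⟩ := hc.1 t t₁ ht₁
    have hY₁ := hmin s hst hX (neg_le_neg hZ)
    obtain ⟨-, hXs, hYs, hmins⟩ := ha.1 s₀ s hs₀
    dsimp only at hZ₁ hY₁
    have hlt : X t₁ + 2 * Y t₁ < X t + 2 * Y t := by
      by_contra hcon
      exact hne (inj _ _ (by linarith) (by linarith))
    have key := ih _ (ncard_between_lt_of_right (fun r => X r + 2 * Y r) (s := s)
      (by linarith) hlt) s t₁ rfl
    by_cases h1 : X s ≤ X t₁
    · exact .head (.inl hs₀) (key.2 t ht₁ hX hZ h1 (by linarith))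
    by_cases h2 : X s + Y s ≤ X t₁ + Y t₁
    · exact (key.1 s₀ hs₀ (by linarith) (by linarith) (by linarith) h2).tail (.inr ht₁)
    -- Here `t₁` is in the quadrant of `s₀` and would be hit before `s`, unless it is `s₀` itself.
    by_cases h3 : t₁ = s₀
    · subst h3
      exact .single (.inr ht₁)
    · exact absurd (hmins t₁ h3 (by linarith) (by linarith)) h2
  · intro t₀ ht₀ hX₀ hZ₀ hX hY
    by_cases hst : s = t
    · subst hst
      exact .single (.inr ht₀)
    obtain ⟨s₁, hs₁⟩ := ha.2 s t (Ne.symm hst) hX hY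
    obtain ⟨hne, hX₁, hY₁, hmin⟩ := ha.1 s s₁ hs₁
    have hZ₁ := hmin t (Ne.symm hst) hX hY
    obtain ⟨-, hXt, hZt, hmint⟩ := hc.1 t₀ t ht₀
    dsimp only at hZt hmint
    have hlt : X s + 2 * Y s < X s₁ + 2 * Y s₁ := by
      by_contra hcon
      exact hne (inj _ _ (by linarith) (by linarith))
    have key := ih _ (ncard_between_lt_of_left (fun r => X r + 2 * Y r) (t := t)
      (by linarith) hlt) s₁ t rfl
    by_cases h1 : X t ≤ X s₁
    · exact (key.1 s hs₁ hX hY h1 hZ₁).tail (.inr ht₀)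
    by_cases h2 : Y s₁ ≤ Y t
    · exact .head (.inl hs₁) (key.2 t₀ ht₀ (by linarith) (by linarith) (by linarith) h2)
    -- Symmetrically, `s₁` is in the wedge of `t₀` with larger Y than `t`, so it would be selected
    -- before `t`, unless it is `t₀`.
    by_cases h3 : s₁ = t₀
    · subst h3
      exact .single (.inl hs₁)
    · exact absurd (hmint s₁ h3 (by linarith) (by linarith)) (by linarith)

/-- If `t` lies in the quadrant of `s`, a chain of selected neighbours joins `s` to `t` that uses
only two of the three corners. -/
theorem reflTransGen_of_mem_quadrant {V : Type*} [Finite V] {X Y : V → ℝ}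
    (inj : ∀ p q, X p = X q → Y p = Y q → p = q) {Ra Rb Rc : V → V → Prop}
    (ha : IsQuadrantSelector X Y Ra)
    (hb : IsQuadrantSelector Y (fun p => -(X p + Y p)) Rb)
    (hc : IsQuadrantSelector X (fun p => -(X p + Y p)) Rc)
    (s t : V) (hX : X s ≤ X t) (hY : Y s ≤ Y t) :
    Relation.ReflTransGen (fun p q => Ra p q ∨ Rc q p) s t ∨
      Relation.ReflTransGen (fun p q => Ra p q ∨ Rb q p) s t := by
  have hb' : IsQuadrantSelector Y (fun p => -(Y p + X p)) Rb := by
    simpa only [add_comm] using hb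
  induction hn : {r | X s + Y s ≤ X r + Y r ∧ X r + Y r ≤ X t + Y t}.ncard
    using Nat.strong_induction_on generalizing s with
  | _ n ih =>
  subst hn
  by_cases hst : t = s
  · subst hst
    exact .inl .refl
  obtain ⟨s₁, hs₁⟩ := ha.2 s t hst hX hY
  obtain ⟨hne, hX₁, hY₁, hmin⟩ := ha.1 s s₁ hs₁
  have hZ₁ := hmin t hst hX hY
  have hlt : X s + Y s < X s₁ + Y s₁ := by
    by_contra hcon
    exact hne (inj _ _ (by linarith) (by linarith))
  by_cases h1 : X t ≤ X s₁
  · exact .inl ((reflTransGen_zigzag inj ha hc s₁ t).1 s hs₁ hX hY h1 hZ₁)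
  by_cases h2 : Y t ≤ Y s₁
  -- The mirror case: exchanging X and Y exchanges the corners C and B.
  · exact .inr ((reflTransGen_zigzag (fun p q h h' => inj p q h' h) ha.symm hb' s₁ t).1 s hs₁
      hY hX h2 (by linarith))
  exact (ih _ (ncard_between_lt_of_left (fun r => X r + Y r) (by linarith) hlt) s₁
    (by linarith) (by linarith) rfl).imp (.head (.inl hs₁)) (.head (.inl hs₁))

/-- A chain of adjacent vertices yields a path that keeps every property of its steps. -/
lemma exists_isPath_of_reflTransGen {V : Type*} {G : SimpleGraph V} {E P : V → V → Prop}
    (h : ∀ p q, E p q → G.Adj p q ∧ P p q) {s t : V} (hst : Relation.ReflTransGen E s t) :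
    ∃ w : G.Walk s t, w.IsPath ∧ ∀ d ∈ w.darts, P d.fst d.snd := by
  classical
  have : ∃ w : G.Walk s t, ∀ d ∈ w.darts, P d.fst d.snd := by
    induction hst using Relation.ReflTransGen.head_induction_on with
    | refl => exact ⟨.nil, by simp⟩
    | head hE _ ih =>
      obtain ⟨w, hw⟩ := ih
      refine ⟨.cons (h _ _ hE).1 w, fun d hd => ?_⟩
      rw [SimpleGraph.Walk.darts_cons, List.mem_cons] at hd
      rcases hd with rfl | hd
      · exact (h _ _ hE).2
      · exact hw d hd
  obtain ⟨w, hw⟩ := this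
  exact ⟨w.bypass, w.bypass_isPath, fun d hd => hw d (w.darts_bypass_subset_darts hd)⟩

/-! ### Directions, cross products and wedges -/

@[simp] lemma dir_zero_apply (θ : ℝ) : dir θ 0 = Real.cos θ := rfl
@[simp] lemma dir_one_apply (θ : ℝ) : dir θ 1 = Real.sin θ := rfl

lemma plane_ext {v w : Plane} (h₀ : v 0 = w 0) (h₁ : v 1 = w 1) : v = w := by
  ext i
  fin_cases i
  · exact h₀
  · exact h₁

lemma dir_add_pi (θ : ℝ) : dir (θ + Real.pi) = -dir θ :=
  plane_ext (by simp) (by simp)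

lemma dir_add_int_mul_two_pi (θ : ℝ) (n : ℤ) : dir (θ + n * (2 * Real.pi)) = dir θ :=
  plane_ext (by simp) (by simp)

lemma cross_dir_dir (θ ψ : ℝ) : cross (dir θ) (dir ψ) = Real.sin (ψ - θ) := by
  simp only [cross, dir_zero_apply, dir_one_apply, Real.sin_sub]
  ring

lemma cross_neg_right (v w : Plane) : cross v (-w) = -cross v w := by
  simp only [cross, PiLp.neg_apply]; ring

lemma cross_comm (v w : Plane) : cross v w = -cross w v := by
  simp only [cross]; ring

lemma cross_sub_left (u v w : Plane) : cross (u - v) w = cross u w - cross v w := by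
  simp only [cross, PiLp.sub_apply]; ring

lemma cross_smul_left (r : ℝ) (v w : Plane) : cross (r • v) w = r * cross v w := by
  simp only [cross, PiLp.smul_apply, smul_eq_mul]; ring

lemma cross_smul_right (r : ℝ) (v w : Plane) : cross v (r • w) = r * cross v w := by
  simp only [cross, PiLp.smul_apply, smul_eq_mul]; ring

/-- Cramer's rule in the plane. -/
lemma cross_smul_eq (e f w : Plane) : cross e f • w = cross w f • e + cross e w • f := by
  apply plane_ext <;> simp only [cross, PiLp.smul_apply, PiLp.add_apply, smul_eq_mul] <;> ring

lemma exists_polar (v : Plane) : ∃ r ψ : ℝ, 0 ≤ r ∧ v = r • dir ψ := by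
  refine ⟨‖(⟨v 0, v 1⟩ : ℂ)‖, Complex.arg ⟨v 0, v 1⟩, norm_nonneg _, ?_⟩
  apply plane_ext
  · simp [Complex.norm_mul_cos_arg]
  · simp [Complex.norm_mul_sin_arg]

/-- Every vector has a polar angle in any half-open interval of length `2π`. -/
lemma exists_polar_Ico (v : Plane) (a : ℝ) :
    ∃ r ψ : ℝ, 0 ≤ r ∧ a ≤ ψ ∧ ψ < a + 2 * Real.pi ∧ v = r • dir ψ := by
  obtain ⟨r, ψ, hr, rfl⟩ := exists_polar v
  have hp : 0 < 2 * Real.pi := by positivity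
  have hmem := toIcoMod_mem_Ico hp a ψ
  refine ⟨r, toIcoMod hp a ψ, hr, hmem.1, hmem.2, ?_⟩
  have := toIcoMod_add_toIcoDiv_zsmul hp a ψ
  rw [zsmul_eq_mul] at this
  rw [← dir_add_int_mul_two_pi (toIcoMod hp a ψ) (toIcoDiv hp a ψ), this]

/-- A wedge narrower than a half-turn is the intersection of two half-planes. With the polar angle
taken in [φ, φ + 2π), the first sign condition bounds it by φ + π and the second by φ + γ. -/
lemma inWedge_iff {φ γ : ℝ} (h₀ : 0 < γ) (hπ : γ < Real.pi) (v : Plane) :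
    InWedge φ γ v ↔ 0 ≤ cross (dir φ) v ∧ 0 ≤ cross v (dir (φ + γ)) := by
  constructor
  · rintro ⟨r, ψ, hr, h1, h2, rfl⟩
    rw [cross_smul_left, cross_smul_right, cross_dir_dir, cross_dir_dir]
    exact ⟨mul_nonneg hr (Real.sin_nonneg_of_nonneg_of_le_pi (by linarith) (by linarith)),
      mul_nonneg hr (Real.sin_nonneg_of_nonneg_of_le_pi (by linarith) (by linarith))⟩
  · rintro ⟨h1, h2⟩
    obtain ⟨r, ψ, hr, ha, hb, rfl⟩ := exists_polar_Ico v φ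
    rcases hr.eq_or_lt with rfl | hr
    · exact ⟨0, φ, le_rfl, le_rfl, by linarith, by simp⟩
    rw [cross_smul_left, cross_dir_dir] at h2
    rw [cross_smul_right, cross_dir_dir] at h1
    replace h1 := nonneg_of_mul_nonneg_right h1 hr
    replace h2 := nonneg_of_mul_nonneg_right h2 hr
    refine ⟨r, ψ, hr.le, ha, ?_, rfl⟩
    by_contra! hcon
    have hle : ψ - φ ≤ Real.pi := by
      by_contra! hlt
      have := Real.sin_neg_of_neg_of_neg_pi_lt (x := ψ - φ - 2 * Real.pi) (by linarith)
        (by linarith)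
      rw [Real.sin_sub_two_pi] at this
      linarith
    have := Real.sin_neg_of_neg_of_neg_pi_lt (x := φ + γ - ψ) (by linarith) (by linarith)
    linarith

/-! ### Side heights as coordinates of the wedges and sweeps -/

/-- The signed distance from the side of `T` opposite to the corner `j`, up to a translation and
normalized by twice the area of `T`; it grows from the corner towards the side. -/
noncomputable def sideHeight (T : Fin 3 → Plane) (j : Fin 3) (p : Plane) : ℝ :=
  cross p (T (j + 2) - T (j + 1)) / cross (T 1 - T 0) (T 2 - T 0)

/-- The three side vectors of a triangle add up to zero. -/
lemma sideHeight_sum (T : Fin 3 → Plane) (j : Fin 3) (p : Plane) :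
    sideHeight T j p + sideHeight T (j + 1) p + sideHeight T (j + 2) p = 0 := by
  fin_cases j <;>
    · simp only [sideHeight, cross, PiLp.sub_apply, ← add_div]
      simp
      left
      ring

lemma eq_add_of_cross_ne_zero {e f : Plane} (h : cross e f ≠ 0) (w : Plane) :
    w = (cross w f / cross e f) • e + (cross e w / cross e f) • f := by
  rw [div_eq_inv_mul, div_eq_inv_mul, mul_smul, mul_smul, ← smul_add, ← cross_smul_eq,
    inv_smul_smul₀ h]

lemma mem_wedge_iff {A B C : Plane} (hD : cross (B - A) (C - A) ≠ 0) (q p : Plane) :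
    p ∈ wedge A B C q ↔ 0 ≤ cross (p - q) (C - A) / cross (B - A) (C - A) ∧
      0 ≤ cross (B - A) (p - q) / cross (B - A) (C - A) := by
  constructor
  · rintro ⟨s, t, hs, ht, rfl⟩
    have h1 : cross (q + s • (B - A) + t • (C - A) - q) (C - A) = s * cross (B - A) (C - A) := by
      simp only [cross, PiLp.sub_apply, PiLp.add_apply, PiLp.smul_apply, smul_eq_mul]; ring
    have h2 : cross (B - A) (q + s • (B - A) + t • (C - A) - q) = t * cross (B - A) (C - A) := by
      simp only [cross, PiLp.sub_apply, PiLp.add_apply, PiLp.smul_apply, smul_eq_mul]; ring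
    rw [h1, h2, mul_div_cancel_right₀ _ hD, mul_div_cancel_right₀ _ hD]
    exact ⟨hs, ht⟩
  · rintro ⟨hs, ht⟩
    refine ⟨_, _, hs, ht, ?_⟩
    rw [add_assoc, ← eq_add_of_cross_ne_zero hD, add_sub_cancel]

lemma mem_sweepLine_iff {A B C : Plane} (hD : cross (B - A) (C - A) ≠ 0) (q p : Plane) (l : ℝ) :
    p ∈ sweepLine A B C q l ↔ l = cross (p - q) (C - B) / cross (B - A) (C - A) := by
  rw [eq_div_iff hD]
  constructor
  · rintro ⟨t, rfl⟩
    simp only [cross, PiLp.sub_apply, PiLp.add_apply, PiLp.smul_apply, smul_eq_mul]; ring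
  · intro h
    refine ⟨cross (B - A) (p - q) / cross (B - A) (C - A), ?_⟩
    have hl : l = cross (p - q) (C - A) / cross (B - A) (C - A) +
        cross (B - A) (p - q) / cross (B - A) (C - A) := by
      rw [← add_div, eq_div_iff hD, h]
      simp only [cross, PiLp.sub_apply]; ring
    have hpq := eq_add_of_cross_ne_zero hD (p - q)
    calc p = q + (p - q) := (add_sub_cancel q p).symm
      _ = q + _ := congrArg (q + ·) hpq
      _ = _ := by rw [hl]; module

/-- The coefficients of `p - q` along the two sides at the corner are the decreases of the other two
side heights, and the sweep time is the increase of the corner's own height. Twice the signed area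
is the same from every corner, so one denominator serves all three. -/
lemma isNearest_iff {S : Finset Plane} {T : Fin 3 → Plane}
    (hT : cross (T 1 - T 0) (T 2 - T 0) ≠ 0) (j : Fin 3) (q p : S) :
    IsNearest S T j q p ↔ p ≠ q ∧ sideHeight T (j + 1) p ≤ sideHeight T (j + 1) q ∧
      sideHeight T (j + 2) p ≤ sideHeight T (j + 2) q ∧
      ∀ r : S, r ≠ q → sideHeight T (j + 1) r ≤ sideHeight T (j + 1) q →
        sideHeight T (j + 2) r ≤ sideHeight T (j + 2) q →
        sideHeight T j p ≤ sideHeight T j r := by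
  have hD : cross (T (j + 1) - T j) (T (j + 2) - T j) = cross (T 1 - T 0) (T 2 - T 0) := by
    fin_cases j <;> simp [cross] <;> ring
  have hw (r : S) : (r : Plane) ∈ wedge (T j) (T (j + 1)) (T (j + 2)) q ↔
      sideHeight T (j + 1) r ≤ sideHeight T (j + 1) q ∧
        sideHeight T (j + 2) r ≤ sideHeight T (j + 2) q := by
    rw [mem_wedge_iff (hD ▸ hT), hD, ← sub_nonneg (b := sideHeight T (j + 1) r),
      ← sub_nonneg (b := sideHeight T (j + 2) r)]
    simp only [sideHeight, ← sub_div]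
    have e1 : (j + 1 + 2 : Fin 3) = j := by omega
    have e2 : (j + 1 + 1 : Fin 3) = j + 2 := by omega
    have e3 : (j + 2 + 2 : Fin 3) = j + 1 := by omega
    have e4 : (j + 2 + 1 : Fin 3) = j := by omega
    rw [e1, e2, e3, e4]
    refine and_congr (iff_of_eq ?_) (iff_of_eq ?_) <;>
      · congr 2
        simp only [cross, PiLp.sub_apply]
        ring
  have hs (r : S) (l : ℝ) : (r : Plane) ∈ sweepLine (T j) (T (j + 1)) (T (j + 2)) q l ↔
      l = sideHeight T j r - sideHeight T j q := by
    rw [mem_sweepLine_iff (hD ▸ hT), hD, cross_sub_left, sub_div]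
    rfl
  simp only [IsNearest, hw, hs, exists_eq_left, forall_eq, sub_le_sub_iff_right, and_imp, and_assoc]

lemma sideHeight_sub (T : Fin 3 → Plane) (j : Fin 3) (p q : Plane) :
    sideHeight T j (p - q) = sideHeight T j p - sideHeight T j q := by
  simp only [sideHeight, cross_sub_left, sub_div]

/-- The heights are negated coordinates in the basis of the two sides at corner `j`, whose
determinant is twice the signed area. -/
lemma cross_eq_sideHeight {T : Fin 3 → Plane} (hT : cross (T 1 - T 0) (T 2 - T 0) ≠ 0)
    (j : Fin 3) (v w : Plane) :
    cross v w = cross (T 1 - T 0) (T 2 - T 0) *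
      (sideHeight T (j + 1) v * sideHeight T (j + 2) w -
        sideHeight T (j + 2) v * sideHeight T (j + 1) w) := by
  simp only [sideHeight, div_mul_div_comm, ← sub_div]
  rw [← mul_div_assoc, eq_div_iff (mul_ne_zero hT hT)]
  fin_cases j <;>
    · simp [cross]
      ring

/-- Two side heights determine a point. -/
lemma eq_of_sideHeight_eq {T : Fin 3 → Plane} (hT : cross (T 1 - T 0) (T 2 - T 0) ≠ 0)
    (j : Fin 3) {p q : Plane} (h₁ : sideHeight T (j + 1) p = sideHeight T (j + 1) q)
    (h₂ : sideHeight T (j + 2) p = sideHeight T (j + 2) q) : p = q := by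
  have h (w : Plane) : cross (p - q) w = 0 := by
    rw [cross_eq_sideHeight hT j, sideHeight_sub, sideHeight_sub, h₁, h₂]
    ring
  rw [← sub_eq_zero, eq_add_of_cross_ne_zero hT (p - q), h, cross_comm (T 1 - T 0) (p - q), h]
  simp

/-- For a clockwise triangle, the clockwise rule breaks all ties. -/
lemma isTieBreak_mostClockwise {S : Finset Plane} {T : Fin 3 → Plane}
    (hT : cross (T 1 - T 0) (T 2 - T 0) < 0) (j : Fin 3) :
    IsTieBreak (IsNearest S T j) (MostClockwise (IsNearest S T j)) := by
  refine ⟨fun q p h => h.1, fun q hq => ?_⟩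
  -- Tied points lie on one sweep line. The largest height of corner `j + 1` is the one closest to
  -- the clockwise side of the wedge.
  obtain ⟨p, hp, hmax⟩ := Set.exists_max_image {p | IsNearest S T j q p}
    (fun p : S => sideHeight T (j + 1) p) (Set.toFinite _) hq
  have hcw : MostClockwise (IsNearest S T j) q p := by
    refine ⟨hp, fun r hr hrp => ?_⟩
    have hle := hmax r hr
    obtain ⟨hpq, hp1, hp2, hp3⟩ := (isNearest_iff hT.ne j q p).1 hp
    obtain ⟨hrq, hr1, hr2, hr3⟩ := (isNearest_iff hT.ne j q r).1 hr
    have h3 := le_antisymm (hp3 r hrq hr1 hr2) (hr3 p hpq hp1 hp2)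
    have sp := sideHeight_sum T j p
    have sq := sideHeight_sum T j q
    have sr := sideHeight_sum T j r
    have hlt : sideHeight T (j + 1) r < sideHeight T (j + 1) p := by
      refine lt_of_le_of_ne hle fun h => hrp (Subtype.ext (eq_of_sideHeight_eq hT.ne j h ?_))
      linarith
    have hpos : 0 < sideHeight T j p - sideHeight T j q := by
      by_contra! hcon
      exact hpq (Subtype.ext (eq_of_sideHeight_eq hT.ne j (by linarith) (by linarith)))
    have key : sideHeight T (j + 1) (p - q) * sideHeight T (j + 2) (r - q) -
        sideHeight T (j + 2) (p - q) * sideHeight T (j + 1) (r - q) =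
        -((sideHeight T j p - sideHeight T j q) *
          (sideHeight T (j + 1) p - sideHeight T (j + 1) r)) := by
      have e1 : sideHeight T (j + 2) p = -sideHeight T j p - sideHeight T (j + 1) p := by linarith
      have e2 : sideHeight T (j + 2) q = -sideHeight T j q - sideHeight T (j + 1) q := by linarith
      have e3 : sideHeight T (j + 2) r = -sideHeight T j p - sideHeight T (j + 1) r := by linarith
      simp only [sideHeight_sub, e1, e2, e3]
      ring
    rw [cross_eq_sideHeight hT.ne j, key]
    exact mul_pos_of_neg_of_neg hT (neg_neg_of_pos (mul_pos hpos (sub_pos.2 hlt)))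
  refine ⟨p, hcw, fun p' hp' => ?_⟩
  by_contra hne
  have h := hp'.2 p hp (Ne.symm hne)
  rw [cross_comm] at h
  linarith [hcw.2 p' hp'.1 hne]

/-- The nearest neighbours at a corner form a quadrant selector in terms of side heights. -/
lemma IsTieBreak.isQuadrantSelector {S : Finset Plane} {T : Fin 3 → Plane}
    (hT : cross (T 1 - T 0) (T 2 - T 0) ≠ 0) {j : Fin 3} {R : S → S → Prop}
    (hR : IsTieBreak (IsNearest S T j) R) :
    IsQuadrantSelector (fun p : S => -sideHeight T (j + 1) p)
      (fun p : S => -sideHeight T (j + 2) p) R := by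
  have hsum (p : S) : -sideHeight T (j + 1) p + -sideHeight T (j + 2) p = sideHeight T j p := by
    linarith [sideHeight_sum T j p]
  constructor
  · intro q p h
    obtain ⟨h1, h2, h3, h4⟩ := (isNearest_iff hT j q p).1 (hR.1 q p h)
    refine ⟨h1, neg_le_neg h2, neg_le_neg h3, fun r hr hf hg => ?_⟩
    rw [hsum, hsum]
    exact h4 r hr (neg_le_neg_iff.1 hf) (neg_le_neg_iff.1 hg)
  · intro q r hr hf hg
    obtain ⟨p, hp, hmin⟩ := Set.exists_min_image
      {p : S | p ≠ q ∧ sideHeight T (j + 1) p ≤ sideHeight T (j + 1) q ∧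
        sideHeight T (j + 2) p ≤ sideHeight T (j + 2) q}
      (fun p : S => sideHeight T j p) (Set.toFinite _)
      ⟨r, hr, neg_le_neg_iff.1 hf, neg_le_neg_iff.1 hg⟩
    exact (hR.2 q ⟨p, (isNearest_iff hT j q p).2 ⟨hp.1, hp.2.1, hp.2.2, fun r h1 h2 h3 =>
      hmin r ⟨h1, h2, h3⟩⟩⟩).exists

/-! ### Layer triangles and angle-monotone paths -/

lemma cross_rotatedTriangle (α θ : ℝ) :
    cross (rotatedTriangle α θ 1 - rotatedTriangle α θ 0)
      (rotatedTriangle α θ 2 - rotatedTriangle α θ 0) = -Real.sin (2 * α) := by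
  simp only [rotatedTriangle, Matrix.cons_val, sub_zero, cross_dir_dir]
  rw [← Real.sin_neg]
  congr 1
  ring

lemma cross_rotatedTriangle_neg {α : ℝ} (h₀ : 0 < α) (h₁ : α < Real.pi / 2) (θ : ℝ) :
    cross (rotatedTriangle α θ 1 - rotatedTriangle α θ 0)
      (rotatedTriangle α θ 2 - rotatedTriangle α θ 0) < 0 := by
  rw [cross_rotatedTriangle]
  exact neg_neg_of_pos (Real.sin_pos_of_pos_of_lt_pi (by linarith) (by linarith))

lemma rotatedTriangle_base (α θ : ℝ) :
    dir (Real.pi / 2 - α - θ) - dir (Real.pi / 2 + α - θ) = (2 * Real.sin α) • dir (-θ) := by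
  have e1 : Real.pi / 2 - α - θ = Real.pi / 2 - (θ + α) := by ring
  have e2 : Real.pi / 2 + α - θ = Real.pi / 2 - (θ - α) := by ring
  rw [e1, e2]
  apply plane_ext
  · simp [Real.cos_pi_div_two_sub, Real.sin_add, Real.sin_sub]
    ring
  · simp [Real.sin_pi_div_two_sub, Real.cos_add, Real.cos_sub]
    ring

/-- With its analogues for corners 1 and 2, this turns signs of side heights into the half-planes of
`inWedge_iff`; the denominator is negative for a clockwise triangle. -/
lemma sideHeight_rotatedTriangle_zero_nonneg_iff {α : ℝ} (h₀ : 0 < α) (h₁ : α < Real.pi / 2)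
    (θ : ℝ) (v : Plane) :
    0 ≤ sideHeight (rotatedTriangle α θ) 0 v ↔ 0 ≤ cross (dir (-θ)) v := by
  have hs : 0 < 2 * Real.sin α := mul_pos two_pos
    (Real.sin_pos_of_pos_of_lt_pi h₀ (by linarith))
  have : rotatedTriangle α θ (0 + 2) - rotatedTriangle α θ (0 + 1) =
      (2 * Real.sin α) • dir (-θ) := rotatedTriangle_base α θ
  rw [sideHeight, this, cross_smul_right, cross_comm v, ← neg_div_neg_eq, mul_neg, neg_neg,
    le_div_iff₀ (neg_pos.2 (cross_rotatedTriangle_neg h₀ h₁ θ)), zero_mul,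
    mul_nonneg_iff_of_pos_left hs]

lemma sideHeight_rotatedTriangle_one_nonpos_iff {α : ℝ} (h₀ : 0 < α) (h₁ : α < Real.pi / 2)
    (θ : ℝ) (v : Plane) :
    sideHeight (rotatedTriangle α θ) 1 v ≤ 0 ↔ 0 ≤ cross (dir (Real.pi / 2 - α - θ)) v := by
  have : rotatedTriangle α θ (1 + 2) - rotatedTriangle α θ (1 + 1) =
      -dir (Real.pi / 2 - α - θ) := zero_sub _
  rw [sideHeight, this, cross_neg_right, ← cross_comm,
    div_le_iff_of_neg (cross_rotatedTriangle_neg h₀ h₁ θ), zero_mul]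

lemma sideHeight_rotatedTriangle_two_nonpos_iff {α : ℝ} (h₀ : 0 < α) (h₁ : α < Real.pi / 2)
    (θ : ℝ) (v : Plane) :
    sideHeight (rotatedTriangle α θ) 2 v ≤ 0 ↔ 0 ≤ cross v (dir (Real.pi / 2 + α - θ)) := by
  have : rotatedTriangle α θ (2 + 2) - rotatedTriangle α θ (2 + 1) =
      dir (Real.pi / 2 + α - θ) := sub_zero _
  rw [sideHeight, this, div_le_iff_of_neg (cross_rotatedTriangle_neg h₀ h₁ θ), zero_mul]

/-- The wedges of the layers at the apex cover the plane. -/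
lemma exists_layer_inWedge {α : ℝ} {k : ℕ} (h₀ : 0 < α) (hk : (k : ℝ) = Real.pi / α) (v : Plane) :
    ∃ i : Fin k, InWedge (Real.pi / 2 - α - (i : ℕ) / (k : ℝ) * (2 * Real.pi)) (2 * α) v := by
  have hkα : (k : ℝ) * α = Real.pi := by rw [hk, div_mul_cancel₀ _ h₀.ne']
  have hkpos : (0 : ℝ) < k := by rw [hk]; positivity
  obtain ⟨r, ψ, hr, h1, h2, rfl⟩ := exists_polar_Ico v (Real.pi / 2 + α - 2 * Real.pi)
  set ρ := ψ - (Real.pi / 2 + α - 2 * Real.pi) with hρ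
  have hα : 0 < 2 * α := by linarith
  have hle := Nat.floor_le (a := ρ / (2 * α)) (div_nonneg (by linarith) hα.le)
  have hlt := Nat.lt_floor_add_one (ρ / (2 * α))
  have hnk : ⌊ρ / (2 * α)⌋₊ < k := by
    rw [Nat.floor_lt (div_nonneg (by linarith) hα.le), div_lt_iff₀ hα]
    linarith
  rw [le_div_iff₀ hα] at hle
  rw [div_lt_iff₀ hα] at hlt
  set n := ⌊ρ / (2 * α)⌋₊
  have hcast : ((k - 1 - n : ℕ) : ℝ) = k - 1 - n := by
    rw [Nat.cast_sub (by omega), Nat.cast_sub (by omega), Nat.cast_one]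
  have hθ : ((k - 1 - n : ℕ) : ℝ) / (k : ℝ) * (2 * Real.pi) =
      2 * Real.pi - 2 * α - n * (2 * α) := by
    rw [hcast, ← hkα]
    field_simp
  -- The sectors are counted counterclockwise by `n`, the layers clockwise; the range of angles
  -- starts at the lower border of the last layer.
  refine ⟨⟨k - 1 - n, by omega⟩, r, ψ, hr, ?_, ?_, rfl⟩ <;> dsimp only <;> rw [hθ] <;> linarith

/-- A three-sweep graph joins two points, the second in the apex wedge of the first, by an
angle-monotone path. -/
lemma IsThreeSweepGraph.exists_isPath {S : Finset Plane} {α : ℝ} (h₀ : 0 < α)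
    (h₁ : α < Real.pi / 4) {θ : ℝ} {G : SimpleGraph S}
    (hG : IsThreeSweepGraph S (rotatedTriangle α θ) G) {s t : S}
    (hst : InWedge (Real.pi / 2 - α - θ) (2 * α) ((t : Plane) - s)) :
    ∃ w : G.Walk s t, w.IsPath ∧ IsAngleMonotoneWalk (Real.pi / 2 + α) w := by
  obtain ⟨R, hR, rfl⟩ := hG
  set T := rotatedTriangle α θ with hTdef
  have h₂ : α < Real.pi / 2 := by linarith
  have hT : cross (T 1 - T 0) (T 2 - T 0) ≠ 0 := (cross_rotatedTriangle_neg h₀ h₂ θ).ne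
  have hsum (p : Plane) : -sideHeight T 0 p = -(-sideHeight T 1 p + -sideHeight T 2 p) := by
    have : sideHeight T 0 p + sideHeight T 1 p + sideHeight T 2 p = 0 := sideHeight_sum T 0 p
    linarith
  have ha : IsQuadrantSelector (fun p : S => -sideHeight T 1 p) (fun p : S => -sideHeight T 2 p)
      (R 0) := (hR 0).isQuadrantSelector hT
  have hb : IsQuadrantSelector (fun p : S => -sideHeight T 2 p) (fun p : S => -sideHeight T 0 p)
      (R 1) := (hR 1).isQuadrantSelector hT
  have hc : IsQuadrantSelector (fun p : S => -sideHeight T 0 p) (fun p : S => -sideHeight T 1 p)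
      (R 2) := (hR 2).isQuadrantSelector hT
  have ha₀ (q p : S) (h : R 0 q p) : sideHeight T 0 q ≤ sideHeight T 0 p := by
    obtain ⟨-, h1, h2, -⟩ := ha.1 q p h
    linarith [hsum p, hsum q]
  have hb₁ (q p : S) (h : R 1 q p) : sideHeight T 1 q ≤ sideHeight T 1 p := by
    obtain ⟨-, h1, h2, -⟩ := hb.1 q p h
    linarith [hsum p, hsum q]
  have hc₂ (q p : S) (h : R 2 q p) : sideHeight T 2 q ≤ sideHeight T 2 p := by
    obtain ⟨-, h1, h2, -⟩ := hc.1 q p h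
    linarith [hsum p, hsum q]
  rw [inWedge_iff (by linarith) (by linarith),
    show Real.pi / 2 - α - θ + 2 * α = Real.pi / 2 + α - θ by ring,
    ← sideHeight_rotatedTriangle_one_nonpos_iff h₀ h₂,
    ← sideHeight_rotatedTriangle_two_nonpos_iff h₀ h₂, sideHeight_sub, sideHeight_sub,
    sub_nonpos, sub_nonpos] at hst
  -- The wedge of A together with the reflected wedge of C, which adjoins it clockwise.
  have hac (p q : S) (h : R 0 p q ∨ R 2 q p) :
      (SimpleGraph.fromRel fun q p => ∃ j : Fin 3, R j q p).Adj p q ∧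
        InWedge (-θ) (Real.pi / 2 + α) ((q : Plane) - p) := by
    rw [inWedge_iff (by linarith) (by linarith),
      show -θ + (Real.pi / 2 + α) = Real.pi / 2 + α - θ by ring,
      ← sideHeight_rotatedTriangle_zero_nonneg_iff h₀ h₂,
      ← sideHeight_rotatedTriangle_two_nonpos_iff h₀ h₂, sideHeight_sub, sideHeight_sub,
      sub_nonneg, sub_nonpos, SimpleGraph.fromRel_adj]
    rcases h with h | h
    · obtain ⟨hne, h1, h2, -⟩ := ha.1 p q h
      exact ⟨⟨hne.symm, .inl ⟨0, h⟩⟩, ha₀ p q h, neg_le_neg_iff.1 h2⟩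
    · obtain ⟨hne, h1, h2, -⟩ := hc.1 q p h
      exact ⟨⟨hne, .inr ⟨2, h⟩⟩, neg_le_neg_iff.1 h1, hc₂ q p h⟩
  -- The wedge of A together with the reflected wedge of B, which adjoins it counterclockwise.
  have hab (p q : S) (h : R 0 p q ∨ R 1 q p) :
      (SimpleGraph.fromRel fun q p => ∃ j : Fin 3, R j q p).Adj p q ∧
        InWedge (Real.pi / 2 - α - θ) (Real.pi / 2 + α) ((q : Plane) - p) := by
    rw [inWedge_iff (by linarith) (by linarith),
      show Real.pi / 2 - α - θ + (Real.pi / 2 + α) = -θ + Real.pi by ring,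
      dir_add_pi, cross_neg_right, ← cross_comm,
      ← sideHeight_rotatedTriangle_zero_nonneg_iff h₀ h₂,
      ← sideHeight_rotatedTriangle_one_nonpos_iff h₀ h₂, sideHeight_sub, sideHeight_sub,
      sub_nonneg, sub_nonpos, SimpleGraph.fromRel_adj]
    rcases h with h | h
    · obtain ⟨hne, h1, h2, -⟩ := ha.1 p q h
      exact ⟨⟨hne.symm, .inl ⟨0, h⟩⟩, neg_le_neg_iff.1 h1, ha₀ p q h⟩
    · obtain ⟨hne, h1, h2, -⟩ := hb.1 q p h
      exact ⟨⟨hne, .inr ⟨1, h⟩⟩, hb₁ q p h, neg_le_neg_iff.1 h2⟩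
  simp only [hsum] at hb hc
  rcases reflTransGen_of_mem_quadrant (fun p q hX hY => Subtype.ext
    (eq_of_sideHeight_eq hT 0 (neg_inj.1 hX) (neg_inj.1 hY))) ha hb hc.symm s t
    (neg_le_neg hst.1) (neg_le_neg hst.2) with h | h
  · obtain ⟨w, hw, hd⟩ := exists_isPath_of_reflTransGen hac h
    exact ⟨w, hw, _, hd⟩
  · obtain ⟨w, hw, hd⟩ := exists_isPath_of_reflTransGen hab h
    exact ⟨w, hw, _, hd⟩

lemma IsLayeredSweepGraph.isAngleMonotone {S : Finset Plane} {α : ℝ} {k : ℕ} (h₀ : 0 < α)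
    (h₁ : α < Real.pi / 4) (hk : (k : ℝ) = Real.pi / α) {H : SimpleGraph S}
    (hH : IsLayeredSweepGraph S α k H) : IsAngleMonotone (Real.pi / 2 + α) H := by
  obtain ⟨G, hG, rfl⟩ := hH
  intro s t
  obtain ⟨i, hi⟩ := exists_layer_inWedge h₀ hk ((t : Plane) - s)
  obtain ⟨w, hw, φ, hφ⟩ := (hG i).exists_isPath h₀ h₁ hi
  refine ⟨w.mapLe (le_iSup G i), (SimpleGraph.Walk.isPath_mapLe _).2 hw, φ, fun d hd => ?_⟩
  rw [SimpleGraph.Walk.mapLe, SimpleGraph.Walk.darts_map, List.mem_map] at hd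
  obtain ⟨d', hd', rfl⟩ := hd
  exact hφ d' hd'

/-! ### Counting edges -/

/-- A graph whose edges are chosen by `|ι|` partial functions of the vertices has at most
`|ι| * |V|` edges. -/
lemma ncard_edgeSet_le {V ι : Type*} [Finite V] [Finite ι] {H : SimpleGraph V}
    {R : ι → V → V → Prop} (hR : ∀ i q p p', R i q p → R i q p' → p = p')
    (hH : ∀ p q, H.Adj p q → ∃ i, R i p q ∨ R i q p) :
    H.edgeSet.ncard ≤ Nat.card ι * Nat.card V := by
  classical
  let f : ι × V → Sym2 V := fun x =>
    -- The loop is a dummy value that makes `f` total; only the inclusion of the edges in its range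
    -- matters.
    if h : ∃ p, R x.1 x.2 p then s(x.2, h.choose) else s(x.2, x.2)
  have hf {i : ι} {q p : V} (h : R i q p) : f (i, q) = s(q, p) := by
    have hex : ∃ p, R i q p := ⟨p, h⟩
    simp only [f, dif_pos hex, hR i q _ _ hex.choose_spec h]
  have hsub : H.edgeSet ⊆ Set.range f := by
    intro e
    induction e with
    | _ p q =>
      intro he
      obtain ⟨i, h | h⟩ := hH p q he
      · exact ⟨(i, p), hf h⟩
      · exact ⟨(i, q), (hf h).trans Sym2.eq_swap⟩
  calc H.edgeSet.ncard ≤ (Set.range f).ncard := Set.ncard_le_ncard hsub (Set.toFinite _)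
    _ ≤ Nat.card (ι × V) := by
      rw [← Set.image_univ, ← Set.ncard_univ]
      exact Set.ncard_image_le (Set.toFinite _)
    _ = _ := Nat.card_prod _ _

lemma IsLayeredSweepGraph.ncard_edgeSet_le {S : Finset Plane} {α : ℝ} {k : ℕ}
    (hk : (k : ℝ) = Real.pi / α) {H : SimpleGraph S} (hH : IsLayeredSweepGraph S α k H) :
    (H.edgeSet.ncard : ℝ) ≤ 3 * Real.pi * (S.card / α) := by
  obtain ⟨G, hG, rfl⟩ := hH
  choose R hR hG using hG
  have h := _root_.ncard_edgeSet_le (H := ⨆ i, G i) (ι := Fin k × Fin 3)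
    (R := fun x => R x.1 x.2)
    (fun x q p p' hp hp' => ((hR x.1 x.2).2 q ⟨p, (hR x.1 x.2).1 q p hp⟩).unique hp hp')
    (fun p q hpq => by
      obtain ⟨i, hi⟩ := SimpleGraph.iSup_adj.1 hpq
      rw [hG i, SimpleGraph.fromRel_adj] at hi
      obtain ⟨-, ⟨j, hj⟩ | ⟨j, hj⟩⟩ := hi
      · exact ⟨(i, j), .inl hj⟩
      · exact ⟨(i, j), .inr hj⟩)
  have h' : ((⨆ i, G i).edgeSet.ncard : ℝ) ≤ (k * 3 : ℝ) * S.card := by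
    simpa using (Nat.cast_le (α := ℝ)).2 h
  refine h'.trans_eq ?_
  rw [hk]
  ring

lemma isLayeredSweepGraph_layeredSweepGraph (S : Finset Plane) {α : ℝ} (k : ℕ) (h₀ : 0 < α)
    (h₁ : α < Real.pi / 2) : IsLayeredSweepGraph S α k (layeredSweepGraph S α k) :=
  ⟨_, fun _ => ⟨_, fun j => isTieBreak_mostClockwise (cross_rotatedTriangle_neg h₀ h₁ _) j, rfl⟩,
    rfl⟩

/-! ### The case α = π/6 and the Θ₆-graph -/

/-- Among the points of `S` other than `q` in the cone with apex `q` and directions in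
`[φ, φ + π / 3]`, `p` is one of those whose projection to the bisector is closest to `q`. -/
def IsConeNearest (S : Finset Plane) (φ : ℝ) (q p : S) : Prop :=
  p ≠ q ∧ InWedge φ (Real.pi / 3) ((p : Plane) - q) ∧
    ∀ r : S, r ≠ q → InWedge φ (Real.pi / 3) ((r : Plane) - q) →
      inner ℝ ((p : Plane) - q) (dir (φ + Real.pi / 6)) ≤
        inner ℝ ((r : Plane) - q) (dir (φ + Real.pi / 6))

lemma inWedge_pi_div_three_iff (φ : ℝ) (v : Plane) :
    InWedge φ (Real.pi / 3) v ↔ 0 ≤ cross (dir φ) v ∧ 0 ≤ cross v (dir (φ + Real.pi / 3)) :=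
  inWedge_iff (by positivity) (by linarith [Real.pi_pos]) v

lemma isConeNearest_add_int_mul_two_pi (S : Finset Plane) (φ : ℝ) (n : ℤ) :
    IsConeNearest S (φ + n * (2 * Real.pi)) = IsConeNearest S φ := by
  ext q p
  simp only [IsConeNearest, inWedge_pi_div_three_iff, add_right_comm φ (n * (2 * Real.pi)),
    dir_add_int_mul_two_pi]

lemma inner_dir_add_pi_div_two (v : Plane) (ψ : ℝ) :
    inner ℝ v (dir (ψ + Real.pi / 2)) = -cross v (dir ψ) := by
  simp [PiLp.inner_apply, cross, Fin.sum_univ_two, Real.cos_add_pi_div_two,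
    Real.sin_add_pi_div_two]
  ring

/-- For `α = π / 6` all sides have length one and directions that differ by `2π / 3`. -/
lemma rotatedTriangle_side (θ : ℝ) (j : Fin 3) :
    rotatedTriangle (Real.pi / 6) θ (j + 2) - rotatedTriangle (Real.pi / 6) θ (j + 1) =
      dir (-θ - (j : ℕ) * (2 * Real.pi / 3)) := by
  fin_cases j
  · refine (rotatedTriangle_base _ θ).trans ?_
    simp
  · refine (zero_sub (dir (Real.pi / 2 - Real.pi / 6 - θ))).trans ?_
    rw [← dir_add_pi, ← dir_add_int_mul_two_pi _ (-1)]
    congr 1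
    push_cast
    ring
  · refine (sub_zero (dir (Real.pi / 2 + Real.pi / 6 - θ))).trans ?_
    rw [← dir_add_int_mul_two_pi _ (-1)]
    congr 1
    push_cast
    ring

lemma rotatedTriangle_side_succ (θ : ℝ) (j : Fin 3) :
    rotatedTriangle (Real.pi / 6) θ (j + 1 + 2) - rotatedTriangle (Real.pi / 6) θ (j + 1 + 1) =
      dir (-θ - (j : ℕ) * (2 * Real.pi / 3) - 2 * Real.pi / 3) := by
  rw [rotatedTriangle_side]
  fin_cases j
  · congr 1; simp
  · congr 1; simp; ring
  · rw [← dir_add_int_mul_two_pi _ (-1)]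
    congr 1; simp; ring

lemma rotatedTriangle_side_succ_succ (θ : ℝ) (j : Fin 3) :
    rotatedTriangle (Real.pi / 6) θ (j + 2 + 2) - rotatedTriangle (Real.pi / 6) θ (j + 2 + 1) =
      dir (-θ - (j : ℕ) * (2 * Real.pi / 3) + 2 * Real.pi / 3) := by
  rw [rotatedTriangle_side]
  fin_cases j
  · rw [← dir_add_int_mul_two_pi _ 1]
    congr 1; simp; ring
  · congr 1; simp
  · congr 1; simp; ring

lemma isNearest_rotatedTriangle (S : Finset Plane) (θ : ℝ) (j : Fin 3) :
    IsNearest S (rotatedTriangle (Real.pi / 6) θ) j =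
      IsConeNearest S (Real.pi / 3 - θ - (j : ℕ) * (2 * Real.pi / 3)) := by
  have hneg := cross_rotatedTriangle_neg (α := Real.pi / 6) (by positivity)
    (by linarith [Real.pi_pos]) θ
  set T := rotatedTriangle (Real.pi / 6) θ with hT
  set φ := Real.pi / 3 - θ - (j : ℕ) * (2 * Real.pi / 3) with hφ
  have h1 (q p : Plane) :
      sideHeight T (j + 1) p ≤ sideHeight T (j + 1) q ↔ 0 ≤ cross (dir φ) (p - q) := by
    rw [← sub_nonpos, ← sideHeight_sub, sideHeight, div_le_iff_of_neg hneg, zero_mul,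
      rotatedTriangle_side_succ, show -θ - (j : ℕ) * (2 * Real.pi / 3) - 2 * Real.pi / 3 =
        φ + Real.pi + (-1 : ℤ) * (2 * Real.pi) by rw [hφ]; push_cast; ring,
      dir_add_int_mul_two_pi, dir_add_pi, cross_neg_right, ← cross_comm]
  have h2 (q p : Plane) : sideHeight T (j + 2) p ≤ sideHeight T (j + 2) q ↔
      0 ≤ cross (p - q) (dir (φ + Real.pi / 3)) := by
    rw [← sub_nonpos, ← sideHeight_sub, sideHeight, div_le_iff_of_neg hneg, zero_mul,
      rotatedTriangle_side_succ_succ, show -θ - (j : ℕ) * (2 * Real.pi / 3) + 2 * Real.pi / 3 =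
        φ + Real.pi / 3 by rw [hφ]; ring]
  -- The bisector is perpendicular to the opposite side, so projection and sweep give the same
  -- order.
  have h3 (q p r : Plane) : sideHeight T j p ≤ sideHeight T j r ↔
      inner ℝ (p - q) (dir (φ + Real.pi / 6)) ≤ inner ℝ (r - q) (dir (φ + Real.pi / 6)) := by
    rw [show φ + Real.pi / 6 = -θ - (j : ℕ) * (2 * Real.pi / 3) + Real.pi / 2 by rw [hφ]; ring,
      inner_dir_add_pi_div_two, inner_dir_add_pi_div_two, sideHeight, sideHeight,
      rotatedTriangle_side, div_le_div_right_of_neg hneg, neg_le_neg_iff, cross_sub_left,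
      cross_sub_left, sub_le_sub_iff_right]
  ext q p
  rw [isNearest_iff hneg.ne]
  simp only [h1, h2, h3 q, IsConeNearest, inWedge_pi_div_three_iff, and_assoc, and_imp]

lemma exists_eq_fin_six_add (z : ℤ) : ∃ (m : Fin 6) (n : ℤ), z = (m : ℕ) + 6 * n := by
  refine ⟨⟨(z % 6).toNat, by omega⟩, z / 6, ?_⟩
  dsimp only
  omega

/-- The layers for `α = π / 6` are equilateral, and their wedges are the cones of the Θ₆-graph. -/
lemma layeredSweepGraph_six (S : Finset Plane) :
    layeredSweepGraph S (Real.pi / 6) 6 = thetaSixGraph S := by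
  have hΘ (m : Fin 6) : IsThetaNearest S m = IsConeNearest S ((m : ℕ) * (Real.pi / 3)) := rfl
  -- Corner `j` of layer `i` has its first side in direction (1 - i - 2j)π/3, so only this integer
  -- modulo 6 matters.
  have hL (i : Fin 6) (j : Fin 3) (m : Fin 6) (n : ℤ)
      (h : (1 - (i : ℕ) - 2 * (j : ℕ) : ℤ) = (m : ℕ) + 6 * n) :
      IsNearest S (layerTriangle (Real.pi / 6) 6 i) j = IsThetaNearest S m := by
    have h' : (1 - (i : ℕ) - 2 * (j : ℕ) : ℝ) = (m : ℕ) + 6 * n := by exact_mod_cast h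
    rw [hΘ, layerTriangle, isNearest_rotatedTriangle,
      ← isConeNearest_add_int_mul_two_pi S ((m : ℕ) * (Real.pi / 3)) n]
    congr 1
    push_cast
    linear_combination (Real.pi / 3) * h'
  have hR (q p : S) : (∃ i j, MostClockwise
      (IsNearest S (layerTriangle (Real.pi / 6) 6 i) j) q p) ↔
      ∃ m, MostClockwise (IsThetaNearest S m) q p := by
    constructor
    · rintro ⟨i, j, h⟩
      obtain ⟨m, n, hm⟩ := exists_eq_fin_six_add (1 - (i : ℕ) - 2 * (j : ℕ))
      exact ⟨m, hL i j m n hm ▸ h⟩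
    · rintro ⟨m, h⟩
      -- The apex corners alone already give all six cones.
      obtain ⟨i, n, hi⟩ := exists_eq_fin_six_add (1 - (m : ℕ))
      refine ⟨i, 0, ?_⟩
      rwa [hL i 0 m n (by simp; omega)]
  ext p q
  simp only [layeredSweepGraph, threeSweepGraph, thetaSixGraph, SimpleGraph.iSup_adj,
    SimpleGraph.fromRel_adj, exists_and_left, exists_or, hR]

theorem mainTheorem2 :
    ∃ c : ℝ, 0 < c ∧ ∀ (α : ℝ) (k : ℕ), 0 < α → α < Real.pi / 4 → (k : ℝ) = Real.pi / α →
      ∀ S : Finset Plane,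
        (IsAngleMonotone (Real.pi / 2 + α) (layeredSweepGraph S α k) ∧
          ((layeredSweepGraph S α k).edgeSet.ncard : ℝ) ≤ c * (S.card / α)) ∧
        (∀ H : SimpleGraph S, IsLayeredSweepGraph S α k H →
          IsAngleMonotone (Real.pi / 2 + α) H ∧
            (H.edgeSet.ncard : ℝ) ≤ c * (S.card / α)) ∧
        (α = Real.pi / 6 → layeredSweepGraph S α k = thetaSixGraph S) := by
  refine ⟨3 * Real.pi, by positivity, fun α k h₀ h₁ hk S => ?_⟩
  have hH (H : SimpleGraph S) (h : IsLayeredSweepGraph S α k H) :=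
    And.intro (h.isAngleMonotone h₀ h₁ hk) (h.ncard_edgeSet_le hk)
  refine ⟨hH _ (isLayeredSweepGraph_layeredSweepGraph S k h₀ (by linarith)), hH, ?_⟩
  rintro rfl
  have hk6 : k = 6 := by
    have : (k : ℝ) = 6 := by rw [hk]; field_simp
    exact_mod_cast this
  subst hk6
  exact layeredSweepGraph_six S
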